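/- **Model.** Let $a,b>0$ and $r\in\mathbb{R}$. Consider the Lorenz '63 equations $x'=a(y-x)$, $y'=rx-y-xz$, $z'=-bz+xy$ in the coordinates $u=(x,\,y,\,z-(r+a))\in\mathbb{R}^3$, in which they read $\frac{du}{dt}=F(u):=-Au-B(u,u)+f$ with $$A=\begin{pmatrix}a&-a&0\\a&1&0\\0&0&b\end{pmatrix},\quad B(u,\tilde u)=\begin{pmatrix}0\\(u_1\tilde u_3+u_3\tilde u_1)/2\\-(u_1\tilde u_2+u_2\tilde u_1)/2\end{pmatrix},\quad f=\begin{pmatrix}0\\0\\-b(r+a)\end{pmatrix}.$$ Only the first coordinate is observed: $H=\mathrm{diag}(1,0,0)$. Let $R,\delta>0$ be such that $\langle F(v),v\rangle\le 0$ whenever $R\le\|v\|\le R+\delta$, and let $\mathcal{B}_R=\{v:\|v\|\le R\}$. Write $\Psi_t$ ($t\ge0$) for the solution semigroup (all solutions started in $\mathcal{B}_R$ exist for all $t\ge 0$ and stay in $\mathcal{B}_R$), $\Psi_{-t}$ for the inverse of $\Psi_t:\mathcal{B}_R\to\Psi_t(\mathcal{B}_R)$, $u(t)=\Psi_t(u)$,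 and $D^iv=\frac{d^i}{dt^i}v(t)\big|_{t=0}$ for the solution $v(t)$ started from $v\in\mathbb{R}^3$. **Observations.** For a step $h>0$ put $t_i=ih$ and $Y_i=Hu(t_i)+Z_i$, where $(Z_i)_{i\ge0}$ are i.i.d. centered random vectors in $\mathbb{R}^3$ with a Lebesgue density $\eta$. Let $q$ be a prior probability density that vanishes outside $\mathcal{B}_R$. The smoother has density proportional to $\prod_{i=0}^k\eta(Y_i-H\Psi_{t_i}(v))\,q(v)$ on $\mathcal{B}_R$ and $0$ elsewhere; the filter has density proportional to $\prod_{i=0}^k\eta(Y_i-H\Psi_{t_i-t_k}(v))\,\det(J\Psi_{-t_k}(v))\,q(\Psi_{-t_k}(v))$ on $\Psi_{t_k}(\mathcal{B}_R)$ and $0$ elsewhere. Their supports are the sets where these densities are non-zero. The noise is called $\epsilon$-bounded if $\|Z_i\|\le\epsilon$ almost surely for every $i$; the density $\eta$ is then taken to vanish at every $z$ with $\|z\|>\epsilon$. **Statement.** 1. For Lebesgue almost every $u\in\mathcal{B}_R$ and every $j\ge2$: $\|u\|<R$; the system of equations $HD^iu=HD^iv$, $0\le i\le j$, has the unique solution $v=u$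 in $\mathcal{B}_R$; and the gradients at $u$ of the functions $w\mapsto (HD^iw)_l$, $0\le i\le j$, $1\le l\le3$, span $\mathbb{R}^3$. 2. For almost every $u\in\mathcal{B}_R$ there is $h_0>0$ such that for every $0<h<h_0$ and every $k\ge2$ there are finite constants $C_{\mathrm{sm}},C_{\mathrm{fi}}$ such that for every $\epsilon>0$, every $\epsilon$-bounded noise and every prior density $q$ as above, almost surely the support of the smoother and the support of the filter given $Y_0,\dots,Y_k$ have diameter at most $C_{\mathrm{sm}}\epsilon$ and $C_{\mathrm{fi}}\epsilon$, respectively. 3. For every $h$ and $k$ there are estimators (measurable functions) $U_{\mathrm{sm}},U_{\mathrm{fi}}$ of $(Y_0,\dots,Y_k)$, chosen independently of $u$ and of the law of the noise, such that for almost every $u\in\mathcal{B}_R$ there is $h_0>0$ such that for every $0<h<h_0$ and every $k\ge2$ there are finite constants $D_{\mathrm{sm}},D_{\mathrm{fi}}$ such that for all noise with $\sigma_Z^2:=\mathbb{E}\|Z_0\|^2<\infty$, $$\mathbb{E}\|U_{\mathrm{sm}}(Y_0,\dots,Y_k)-u\|^2\le D_{\mathrm{sm}}\sigma_Z^2,\qquad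 \mathbb{E}\|U_{\mathrm{fi}}(Y_0,\dots,Y_k)-u(t_k)\|^2\le D_{\mathrm{fi}}\sigma_Z^2 .$$ -/

import Mathlib

open MeasureTheory ProbabilityTheory Set Filter Topology
open scoped ENNReal

universe w

/-- A partially observed system on `ℝ^d`, with `m` observed components:
the signal solves `du/dt = -A u - B(u, u) + f` and is observed through `H u`. -/
structure ObservedSystem (d m : ℕ) where
  /-- linear part -/
  A : EuclideanSpace ℝ (Fin d) →ₗ[ℝ] EuclideanSpace ℝ (Fin d)
  /-- bilinear part -/
  B : EuclideanSpace ℝ (Fin d) →ₗ[ℝ] EuclideanSpace ℝ (Fin d) →ₗ[ℝ] EuclideanSpace ℝ (Fin d)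
  /-- constant forcing -/
  f : EuclideanSpace ℝ (Fin d)
  /-- observation operator -/
  H : EuclideanSpace ℝ (Fin d) →ₗ[ℝ] EuclideanSpace ℝ (Fin m)

namespace ObservedSystem

noncomputable section

variable {d m : ℕ} (S : ObservedSystem d m)

/-- The right-hand side `-A v - B(v, v) + f` of the differential equation. -/
def field (v : EuclideanSpace ℝ (Fin d)) : EuclideanSpace ℝ (Fin d) :=
  -(S.A v) - S.B v v + S.f

/-- The trapping ball condition: the field does not point outwards on the shell
`R ≤ ‖v‖ ≤ R + δ`. -/
def TrappingBall (R δ : ℝ) : Prop :=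
  ∀ v : EuclideanSpace ℝ (Fin d), ‖v‖ ∈ Icc R (R + δ) → inner ℝ (S.field v) v ≤ 0

/-- `γ` solves the differential equation on a neighbourhood of time `0`, started from `v`. -/
def IsLocalSolution (v : EuclideanSpace ℝ (Fin d)) (γ : ℝ → EuclideanSpace ℝ (Fin d)) : Prop :=
  γ 0 = v ∧ ∀ᶠ t in 𝓝 (0 : ℝ), HasDerivAt γ (S.field (γ t)) t

/-- `γ` solves the differential equation for all times `t ≥ 0`, started from `v`. -/
def IsForwardSolution (v : EuclideanSpace ℝ (Fin d)) (γ : ℝ → EuclideanSpace ℝ (Fin d)) : Prop :=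
  γ 0 = v ∧ ∀ t : ℝ, 0 ≤ t → HasDerivWithinAt γ (S.field (γ t)) (Ici 0) t

theorem contDiff_field : ContDiff ℝ 1 S.field := by
  have hA : ContDiff ℝ 1 (fun v => S.A v) := (LinearMap.toContinuousLinearMap S.A).contDiff
  have hB : ContDiff ℝ 1 (fun v => S.B v v) := by
    have h : ContDiff ℝ 1 (fun v => S.B.toContinuousBilinearMap v v) := by fun_prop
    exact h
  exact (hA.neg.sub hB).add contDiff_const

theorem exists_isLocalSolution (v : EuclideanSpace ℝ (Fin d)) : ∃ γ, S.IsLocalSolution v γ := by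
  obtain ⟨γ, h0, ε, hε, hγ⟩ :=
    ContDiffAt.exists_forall_mem_closedBall_exists_eq_forall_mem_Ioo_hasDerivAt₀
      S.contDiff_field.contDiffAt (x₀ := v) 0
  exact ⟨γ, h0, Filter.eventually_of_mem (Ioo_mem_nhds (by linarith) (by linarith)) hγ⟩

/-- A solution of the differential equation near time `0` started from `v`
(its germ at time `0` is unique). -/
def localSolution (v : EuclideanSpace ℝ (Fin d)) : ℝ → EuclideanSpace ℝ (Fin d) :=
  (S.exists_isLocalSolution v).choose

/-- `D^i v`, the `i`-th time derivative at time `0` of the solution started from `v`. -/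
def D (i : ℕ) (v : EuclideanSpace ℝ (Fin d)) : EuclideanSpace ℝ (Fin d) :=
  iteratedDeriv i (S.localSolution v) 0

open Classical in
/-- The solution semigroup `Ψ_t(v)`, `t ≥ 0`: the position at time `t` of the (unique) solution
on `[0, ∞)` started from `v`. The value is junk for points `v` from which the solution blows up. -/
def flow (t : ℝ) (v : EuclideanSpace ℝ (Fin d)) : EuclideanSpace ℝ (Fin d) :=
  if h : ∃ γ, S.IsForwardSolution v γ then h.choose t else v

/-- `Ψ_{-t}`, the inverse of `Ψ_t : B_R → Ψ_t(B_R)`. -/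
def flowInv (R t : ℝ) : EuclideanSpace ℝ (Fin d) → EuclideanSpace ℝ (Fin d) :=
  Function.invFunOn (S.flow t) (Metric.closedBall 0 R)

/-- The assumption on derivatives at the point `u`, with index `j`: `‖u‖ < R`; the system
`H D^i u = H D^i v` for `0 ≤ i ≤ j` has the unique solution `v = u` in `B_R`; and the gradients
at `u` of the coordinates of `H D^i`, `0 ≤ i ≤ j`, span the whole space. -/
def DerivativeAssumption (R : ℝ) (u : EuclideanSpace ℝ (Fin d)) (j : ℕ) : Prop :=
  ‖u‖ < R ∧
  (∀ v ∈ Metric.closedBall (0 : EuclideanSpace ℝ (Fin d)) R,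
    (∀ i ≤ j, S.H (S.D i u) = S.H (S.D i v)) → v = u) ∧
  Submodule.span ℝ {g : EuclideanSpace ℝ (Fin d) | ∃ i ≤ j, ∃ l : Fin m,
    g = gradient (fun w => S.H (S.D i w) l) u} = ⊤

/-- The observations `Y_i = H u(t_i) + Z_i`, `0 ≤ i ≤ k`, at the times `t_i = i h`, where `u(t)`
is the signal started from `u` and `z` is the realisation of the noise. -/
def observations (h : ℝ) (k : ℕ) (u : EuclideanSpace ℝ (Fin d))
    (z : ℕ → EuclideanSpace ℝ (Fin m)) : Fin (k + 1) → EuclideanSpace ℝ (Fin m) :=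
  fun i => S.H (S.flow ((i : ℕ) * h) u) + z i

open Classical in
/-- The unnormalised density of the smoothing distribution (the law of `u(0)` given the
observations `Y_0, …, Y_k`) for the noise density `η` and the prior density `q` on `B_R`. -/
def smootherWeight (R h : ℝ) (k : ℕ) (η : EuclideanSpace ℝ (Fin m) → ℝ≥0∞)
    (q : EuclideanSpace ℝ (Fin d) → ℝ≥0∞) (Y : Fin (k + 1) → EuclideanSpace ℝ (Fin m))
    (v : EuclideanSpace ℝ (Fin d)) : ℝ≥0∞ :=
  if v ∈ Metric.closedBall (0 : EuclideanSpace ℝ (Fin d)) R then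
    (∏ i : Fin (k + 1), η (Y i - S.H (S.flow ((i : ℕ) * h) v))) * q v
  else 0

/-- The density of the smoothing distribution. -/
def smootherDensity (R h : ℝ) (k : ℕ) (η : EuclideanSpace ℝ (Fin m) → ℝ≥0∞)
    (q : EuclideanSpace ℝ (Fin d) → ℝ≥0∞) (Y : Fin (k + 1) → EuclideanSpace ℝ (Fin m))
    (v : EuclideanSpace ℝ (Fin d)) : ℝ≥0∞ :=
  S.smootherWeight R h k η q Y v / ∫⁻ w, S.smootherWeight R h k η q Y w

/-- The support of the smoother: the points where its density is non-zero. -/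
def smootherSupport (R h : ℝ) (k : ℕ) (η : EuclideanSpace ℝ (Fin m) → ℝ≥0∞)
    (q : EuclideanSpace ℝ (Fin d) → ℝ≥0∞) (Y : Fin (k + 1) → EuclideanSpace ℝ (Fin m)) :
    Set (EuclideanSpace ℝ (Fin d)) :=
  {v | S.smootherDensity R h k η q Y v ≠ 0}

open Classical in
/-- The unnormalised density of the filtering distribution (the law of `u(t_k)` given the
observations `Y_0, …, Y_k`). Here `Ψ_{t_i - t_k}(v) = Ψ_{t_i}(Ψ_{-t_k}(v))`, and
the Jacobian determinant of `Ψ_{-t_k}` at `v` is written as the inverse of the Jacobian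
determinant of `Ψ_{t_k}` at `Ψ_{-t_k}(v)`. -/
def filterWeight (R h : ℝ) (k : ℕ) (η : EuclideanSpace ℝ (Fin m) → ℝ≥0∞)
    (q : EuclideanSpace ℝ (Fin d) → ℝ≥0∞) (Y : Fin (k + 1) → EuclideanSpace ℝ (Fin m))
    (v : EuclideanSpace ℝ (Fin d)) : ℝ≥0∞ :=
  if v ∈ S.flow (k * h) '' Metric.closedBall (0 : EuclideanSpace ℝ (Fin d)) R then
    (∏ i : Fin (k + 1), η (Y i - S.H (S.flow ((i : ℕ) * h) (S.flowInv R (k * h) v)))) *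
      ENNReal.ofReal ((fderiv ℝ (S.flow (k * h)) (S.flowInv R (k * h) v)).det)⁻¹ *
      q (S.flowInv R (k * h) v)
  else 0

/-- The density of the filtering distribution. -/
def filterDensity (R h : ℝ) (k : ℕ) (η : EuclideanSpace ℝ (Fin m) → ℝ≥0∞)
    (q : EuclideanSpace ℝ (Fin d) → ℝ≥0∞) (Y : Fin (k + 1) → EuclideanSpace ℝ (Fin m))
    (v : EuclideanSpace ℝ (Fin d)) : ℝ≥0∞ :=
  S.filterWeight R h k η q Y v / ∫⁻ w, S.filterWeight R h k η q Y w

/-- The support of the filter: the points where its density is non-zero. -/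
def filterSupport (R h : ℝ) (k : ℕ) (η : EuclideanSpace ℝ (Fin m) → ℝ≥0∞)
    (q : EuclideanSpace ℝ (Fin d) → ℝ≥0∞) (Y : Fin (k + 1) → EuclideanSpace ℝ (Fin m)) :
    Set (EuclideanSpace ℝ (Fin d)) :=
  {v | S.filterDensity R h k η q Y v ≠ 0}

end

end ObservedSystem

/-- `q` is a probability density on `ℝ^d` that vanishes outside the ball `B_R`. -/
structure IsPriorDensity {d : ℕ} (R : ℝ) (q : EuclideanSpace ℝ (Fin d) → ℝ≥0∞) : Prop where
  measurable : Measurable q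
  lintegral_eq_one : ∫⁻ v, q v = 1
  eq_zero : ∀ v, R < ‖v‖ → q v = 0

/-- `(Z_i)` is a sequence of i.i.d. centered random vectors in `ℝ^m` with density `η`. -/
structure IsObservationNoise {Ω : Type*} [MeasurableSpace Ω] (P : Measure Ω) {m : ℕ}
    (η : EuclideanSpace ℝ (Fin m) → ℝ≥0∞) (Z : ℕ → Ω → EuclideanSpace ℝ (Fin m)) : Prop where
  measurable : ∀ i, Measurable (Z i)
  indep : iIndepFun Z P
  measurable_density : Measurable η
  map_eq : ∀ i, P.map (Z i) = (volume : Measure (EuclideanSpace ℝ (Fin m))).withDensity η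
  integrable : ∀ i, Integrable (Z i) P
  centered : ∀ i, ∫ ω, Z i ω ∂P = 0

/-- The bilinear part
`B(u, v) = (0, (u₁ v₃ + u₃ v₁) / 2, -(u₁ v₂ + u₂ v₁) / 2)` of the Lorenz '63 model. -/
noncomputable def lorenz63B : EuclideanSpace ℝ (Fin 3) →ₗ[ℝ] EuclideanSpace ℝ (Fin 3) →ₗ[ℝ]
    EuclideanSpace ℝ (Fin 3) :=
  LinearMap.mk₂ ℝ
    (fun u v => !₂[0, (u 0 * v 2 + u 2 * v 0) / 2, -((u 0 * v 1 + u 1 * v 0) / 2)])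
    (by intro u u' v; ext i; fin_cases i <;> simp <;> ring)
    (by intro c u v; ext i; fin_cases i <;> simp <;> ring)
    (by intro u v v'; ext i; fin_cases i <;> simp <;> ring)
    (by intro c u v; ext i; fin_cases i <;> simp <;> ring)

/-- The Lorenz '63 model `x' = a (y - x)`, `y' = r x - y - x z`, `z' = -b z + x y`, in the
coordinates `u = (x, y, z - (r + a))`, in which it has the form `u' = -A u - B(u, u) + f`;
only the first coordinate is observed. -/
noncomputable def lorenz63 (a b r : ℝ) : ObservedSystem 3 3 where
  A := Matrix.toEuclideanLin !![a, -a, 0; a, 1, 0; 0, 0, b]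
  B := lorenz63B
  f := !₂[0, 0, -(b * (r + a))]
  H := Matrix.toEuclideanLin !![1, 0, 0; 0, 0, 0; 0, 0, 0]

/-! ### Forward solutions, the trapping ball and the semigroup. -/

namespace ObservedSystem

variable {d m : ℕ} (S : ObservedSystem d m)

/-! Along a solution the observed coordinate and its first two time derivatives are `x`, `a (y - x)`
and an expression whose only dependence on `z` is the term `-a x z`. If `x ≠ 0` at `u`, these
numbers give back `x`, then `y`, then, after division by `x`, `z`. The recovery is quantitative: on
the ball, `‖v - u‖` is at most a constant times the sum of the three discrepancies
(`norm_sub_le_of_derivatives`). The plane `x = 0` and the sphere `‖u‖ = R` are null sets, which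
gives the almost everywhere quantifier.

To pass from derivatives to the observations at times `0, h, 2h`, the difference of two trajectories
is expanded to second order. Since the third derivative is Lipschitz in the state, the remainder is
`O(h³ ‖v - u‖)` and not merely `O(h³)`. Finite differences therefore recover the derivative
discrepancies up to an error `O(h ‖v - u‖)`, which for small `h` is absorbed on the left. The
outcome, `exists_norm_sub_le_of_observations`, is a bound `‖v - u‖ ≤ C ρ` for every `v` in the ball
whose first three observations are within `ρ` of those of `u`; it is global, so no separate local
inversion and compactness argument is needed.

Both error bounds follow. A point of the smoother support has observations within `2 ε` of those of
`u`. A least squares estimator has residual at most that of `u`, which is the total squared noise;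
its measurability comes from a selection theorem. Filter statements are transported by the flow,
which is Lipschitz on the ball by Grönwall. -/

theorem exists_lipschitzOnWith_field (ρ : ℝ) :
    ∃ K, LipschitzOnWith K S.field (Metric.closedBall 0 ρ) :=
  S.contDiff_field.locallyLipschitz.locallyLipschitzOn.exists_lipschitzOnWith_of_compact
    (isCompact_closedBall 0 ρ)

variable {S}

theorem IsForwardSolution.continuousOn {v : EuclideanSpace ℝ (Fin d)}
    {γ : ℝ → EuclideanSpace ℝ (Fin d)} (hγ : S.IsForwardSolution v γ) :
    ContinuousOn γ (Ici 0) :=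
  fun t ht => (hγ.2 t ht).continuousWithinAt

/-- The field is only locally Lipschitz, but up to a fixed time both arcs are compact, so they lie
in one ball on which a Lipschitz constant exists. -/
theorem IsForwardSolution.eqOn {v : EuclideanSpace ℝ (Fin d)}
    {γ γ' : ℝ → EuclideanSpace ℝ (Fin d)} (hγ : S.IsForwardSolution v γ)
    (hγ' : S.IsForwardSolution v γ') : EqOn γ γ' (Ici 0) := by
  intro T hT
  have hc := hγ.continuousOn.mono (Icc_subset_Ici_self : Icc 0 T ⊆ Ici 0)
  have hc' := hγ'.continuousOn.mono (Icc_subset_Ici_self : Icc 0 T ⊆ Ici 0)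
  obtain ⟨ρ, hρ⟩ := (isCompact_Icc.image_of_continuousOn hc).isBounded.subset_closedBall 0
  obtain ⟨ρ', hρ'⟩ := (isCompact_Icc.image_of_continuousOn hc').isBounded.subset_closedBall 0
  obtain ⟨K, hK⟩ := S.exists_lipschitzOnWith_field (max ρ ρ')
  refine ODE_solution_unique_of_mem_Icc_right (v := fun _ => S.field) (K := K)
    (s := fun _ => Metric.closedBall 0 (max ρ ρ')) (fun t _ => hK) hc
    (fun t ht => (hγ.2 t ht.1).mono (Ici_subset_Ici.2 ht.1)) (fun t ht => ?_) hc'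
    (fun t ht => (hγ'.2 t ht.1).mono (Ici_subset_Ici.2 ht.1)) (fun t ht => ?_)
    (hγ.1.trans hγ'.1.symm) ⟨hT, le_rfl⟩
  · exact Metric.closedBall_subset_closedBall (le_max_left _ _)
      (hρ (mem_image_of_mem _ ⟨ht.1, ht.2.le⟩))
  · exact Metric.closedBall_subset_closedBall (le_max_right _ _)
      (hρ' (mem_image_of_mem _ ⟨ht.1, ht.2.le⟩))

end ObservedSystem

/-- A bounded, globally Lipschitz autonomous differential equation has a solution on `[0, ∞)`
through every point. -/
theorem exists_hasDerivWithinAt_Ici_of_lipschitzWith {E : Type*} [NormedAddCommGroup E]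
    [NormedSpace ℝ E] [CompleteSpace E] {G : E → E} {K L : NNReal} (hK : LipschitzWith K G)
    (hL : ∀ x, ‖G x‖ ≤ L) (v : E) :
    ∃ γ : ℝ → E, γ 0 = v ∧ ∀ t, 0 ≤ t → HasDerivWithinAt γ (G (γ t)) (Ici 0) t := by
  have key : ∀ n : ℕ, ∃ γ : ℝ → E, γ 0 = v ∧
      ∀ t ∈ Icc (0 : ℝ) n, HasDerivWithinAt γ (G (γ t)) (Icc 0 (n : ℝ)) t := by
    intro n
    -- With speed at most `L`, the solution cannot leave the ball of radius `L * n` before time `n`,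
    -- so Picard–Lindelöf covers all of `[0, n]`.
    have hPL : IsPicardLindelof (fun _ : ℝ => G) (tmin := 0) (tmax := n)
        ⟨0, left_mem_Icc.2 n.cast_nonneg⟩ v (L * n) 0 L K :=
      { lipschitzOnWith := fun _ _ => hK.lipschitzOnWith
        continuousOn := fun _ _ => continuousOn_const
        norm_le := fun _ _ x _ => hL x
        mul_max_le := by simp }
    exact hPL.exists_eq_forall_mem_Icc_hasDerivWithinAt₀
  choose γ h0 hγ using key
  have hR : ∀ n : ℕ, ∀ t ∈ Ico (0 : ℝ) n, HasDerivWithinAt (γ n) (G (γ n t)) (Ici t) t := by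
    intro n t ht
    refine (hγ n t ⟨ht.1, ht.2.le⟩).mono_of_mem_nhdsWithin ?_
    exact mem_of_superset (Icc_mem_nhdsGE ht.2) (Icc_subset_Icc_left ht.1)
  have agree : ∀ n k : ℕ, ∀ t : ℝ, 0 ≤ t → t ≤ n → t ≤ k → γ n t = γ k t := by
    intro n k t ht hn hk
    have hc : ∀ l : ℕ, t ≤ l → ContinuousOn (γ l) (Icc 0 t) := fun l hl s hs =>
      ((hγ l s ⟨hs.1, hs.2.trans hl⟩).continuousWithinAt).mono (Icc_subset_Icc_right hl)
    exact ODE_solution_unique (v := fun _ => G) (fun _ => hK) (hc n hn)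
      (fun s hs => hR n s ⟨hs.1, hs.2.trans_le hn⟩) (hc k hk)
      (fun s hs => hR k s ⟨hs.1, hs.2.trans_le hk⟩) ((h0 n).trans (h0 k).symm) ⟨ht, le_rfl⟩
  refine ⟨fun t => γ ⌈t⌉₊ t, h0 _, fun t ht => ?_⟩
  -- The extra `1` keeps `t` away from the right end of the interval, so a derivative within `[0,
  -- n]` is one within `[0, ∞)`.
  have hlt : t < ((⌈t⌉₊ + 1 : ℕ) : ℝ) := by
    push_cast; linarith [Nat.le_ceil t]
  have h1 : ∀ s ∈ Icc (0 : ℝ) ((⌈t⌉₊ + 1 : ℕ) : ℝ), γ ⌈s⌉₊ s = γ (⌈t⌉₊ + 1) s :=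
    fun s hs => agree _ _ s hs.1 (Nat.le_ceil s) hs.2
  have h2 := (hγ (⌈t⌉₊ + 1) t ⟨ht, hlt.le⟩).congr h1 (h1 t ⟨ht, hlt.le⟩)
  rw [← h1 t ⟨ht, hlt.le⟩] at h2
  refine h2.mono_of_mem_nhdsWithin ?_
  rw [← Ici_inter_Iic]
  exact inter_mem self_mem_nhdsWithin (mem_nhdsWithin_of_mem_nhds (Iic_mem_nhds hlt))

/-- A solution stays in the ball of radius `R` if the field does not point outwards outside it. -/
theorem norm_le_of_inner_nonpos {E : Type*} [NormedAddCommGroup E] [InnerProductSpace ℝ E]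
    {G : E → E} {R : ℝ} (hG : ∀ x, R ≤ ‖x‖ → inner ℝ (G x) x ≤ 0) (hR : 0 ≤ R) {γ : ℝ → E}
    (h0 : ‖γ 0‖ ≤ R) (hγ : ∀ t, 0 ≤ t → HasDerivWithinAt γ (G (γ t)) (Ici 0) t)
    {t : ℝ} (ht : 0 ≤ t) : ‖γ t‖ ≤ R := by
  have hder : ∀ s, 0 ≤ s → HasDerivWithinAt (fun s => ‖γ s‖ ^ 2)
      (2 * inner ℝ (γ s) (G (γ s))) (Ici 0) s := fun s hs => (hγ s hs).norm_sq
  -- The comparison principle needs a strict inequality of slopes at contact, hence a barrier of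
  -- slope `ε > 0`, with `ε → 0` afterwards.
  have key : ∀ ε : ℝ, 0 < ε → ‖γ t‖ ^ 2 ≤ R ^ 2 + ε * (1 + t) := by
    intro ε hε
    refine image_le_of_deriv_right_lt_deriv_boundary (f := fun s => ‖γ s‖ ^ 2)
      (B := fun s => R ^ 2 + ε * (1 + s)) (B' := fun _ => ε) (a := 0) (b := t)
      (fun s hs => (hder s hs.1).continuousWithinAt.mono Icc_subset_Ici_self)
      (fun s hs => (hder s hs.1).mono (Ici_subset_Ici.2 hs.1)) ?_ (fun s => ?_) ?_ ⟨ht, le_rfl⟩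
    · have := pow_le_pow_left₀ (norm_nonneg _) h0 2
      simp only [add_zero, mul_one]
      linarith
    · simpa using (((hasDerivAt_id s).const_add 1).const_mul ε).const_add (R ^ 2)
    · intro s hs hs'
      have h1 : R ≤ ‖γ s‖ := by
        refine le_of_sq_le_sq ?_ (norm_nonneg _)
        have : 0 ≤ ε * (1 + s) := mul_nonneg hε.le (by linarith [hs.1])
        linarith
      have h2 := hG _ h1
      rw [real_inner_comm] at h2
      linarith
  have h3 : ‖γ t‖ ^ 2 ≤ R ^ 2 := by
    refine le_of_forall_pos_le_add fun ε hε => ?_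
    have := key (ε / (1 + t)) (by positivity)
    rwa [div_mul_cancel₀ _ (by positivity)] at this
  exact le_of_sq_le_sq h3 hR

namespace ObservedSystem

variable {d m : ℕ} {S : ObservedSystem d m} {R δ : ℝ}

/-- Cut the field off by a bump equal to `1` on the ball and `0` beyond radius `R + δ`. The result
is bounded, globally Lipschitz, and points nowhere outwards outside the ball: by hypothesis on the
shell, trivially beyond it. Its solutions stay in the ball, where the cutoff is invisible. -/
theorem TrappingBall.exists_isForwardSolution (hS : S.TrappingBall R δ) (hR : 0 < R) (hδ : 0 < δ)
    {v : EuclideanSpace ℝ (Fin d)} (hv : v ∈ Metric.closedBall 0 R) :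
    ∃ γ, S.IsForwardSolution v γ ∧ ∀ t, 0 ≤ t → γ t ∈ Metric.closedBall 0 R := by
  let χ : ContDiffBump (0 : EuclideanSpace ℝ (Fin d)) := ⟨R, R + δ, hR, by linarith⟩
  let G : EuclideanSpace ℝ (Fin d) → EuclideanSpace ℝ (Fin d) := fun x => χ x • S.field x
  have hG1 : ContDiff ℝ 1 G := χ.contDiff.smul S.contDiff_field
  have hGs : HasCompactSupport G := χ.hasCompactSupport.smul_right
  obtain ⟨K, hK⟩ := hG1.lipschitzWith_of_hasCompactSupport hGs one_ne_zero
  obtain ⟨L, hL⟩ := hGs.exists_bound_of_continuous hG1.continuous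
  obtain ⟨γ, h0, hγ⟩ := exists_hasDerivWithinAt_Ici_of_lipschitzWith hK (L := L.toNNReal)
    (fun x => (hL x).trans (Real.le_coe_toNNReal L)) v
  have hin : ∀ x, R ≤ ‖x‖ → inner ℝ (G x) x ≤ 0 := by
    intro x hx
    rcases le_or_gt ‖x‖ (R + δ) with h | h
    · simp only [G, real_inner_smul_left]
      exact mul_nonpos_of_nonneg_of_nonpos χ.nonneg (hS x ⟨hx, h⟩)
    · have : χ x = 0 := χ.zero_of_le_dist (by simpa using h.le)
      simp [G, this]
  have hmem : ∀ t, 0 ≤ t → γ t ∈ Metric.closedBall 0 R := by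
    intro t ht
    rw [mem_closedBall_zero_iff] at hv ⊢
    exact norm_le_of_inner_nonpos hin hR.le (h0 ▸ hv) hγ ht
  refine ⟨γ, ⟨h0, fun t ht => ?_⟩, hmem⟩
  have h := hγ t ht
  have h1 : χ (γ t) = 1 := χ.one_of_mem_closedBall (hmem t ht)
  simpa only [G, h1, one_smul] using h

theorem TrappingBall.isForwardSolution_flow (hS : S.TrappingBall R δ) (hR : 0 < R) (hδ : 0 < δ)
    {v : EuclideanSpace ℝ (Fin d)} (hv : v ∈ Metric.closedBall 0 R) :
    S.IsForwardSolution v (fun t => S.flow t v) := by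
  obtain ⟨γ, hγ, -⟩ := hS.exists_isForwardSolution hR hδ hv
  have h : ∃ γ, S.IsForwardSolution v γ := ⟨γ, hγ⟩
  have : (fun t => S.flow t v) = h.choose := by
    ext1 t
    simp only [flow, dif_pos h]
  rw [this]
  exact h.choose_spec

theorem TrappingBall.flow_mem (hS : S.TrappingBall R δ) (hR : 0 < R) (hδ : 0 < δ)
    {v : EuclideanSpace ℝ (Fin d)} (hv : v ∈ Metric.closedBall 0 R) {t : ℝ} (ht : 0 ≤ t) :
    S.flow t v ∈ Metric.closedBall 0 R := by
  obtain ⟨γ, hγ, hm⟩ := hS.exists_isForwardSolution hR hδ hv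
  have := (hS.isForwardSolution_flow hR hδ hv).eqOn hγ ht
  rw [show S.flow t v = γ t from this]
  exact hm t ht

/-- Grönwall, with the Lipschitz constant of the field on the ball, which the trajectories never
leave. -/
theorem TrappingBall.exists_norm_flow_sub_le (hS : S.TrappingBall R δ) (hR : 0 < R) (hδ : 0 < δ) :
    ∃ K : ℝ, 0 ≤ K ∧ ∀ v ∈ Metric.closedBall (0 : EuclideanSpace ℝ (Fin d)) R,
      ∀ w ∈ Metric.closedBall (0 : EuclideanSpace ℝ (Fin d)) R, ∀ t, 0 ≤ t →
        ‖S.flow t v - S.flow t w‖ ≤ ‖v - w‖ * Real.exp (K * t) := by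
  obtain ⟨K, hK⟩ := S.exists_lipschitzOnWith_field R
  refine ⟨K, K.2, fun v hv w hw t ht => ?_⟩
  have hv' := hS.isForwardSolution_flow hR hδ hv
  have hw' := hS.isForwardSolution_flow hR hδ hw
  have := dist_le_of_trajectories_ODE_of_mem (v := fun _ => S.field) (K := K)
    (s := fun _ => Metric.closedBall 0 R) (f := fun t => S.flow t v) (g := fun t => S.flow t w)
    (a := 0) (b := t) (δ := ‖v - w‖) (fun t _ => hK)
    (hv'.continuousOn.mono Icc_subset_Ici_self)
    (fun t ht => (hv'.2 t ht.1).mono (Ici_subset_Ici.2 ht.1))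
    (fun t ht => hS.flow_mem hR hδ hv ht.1)
    (hw'.continuousOn.mono Icc_subset_Ici_self)
    (fun t ht => (hw'.2 t ht.1).mono (Ici_subset_Ici.2 ht.1))
    (fun t ht => hS.flow_mem hR hδ hw ht.1)
    (by
      have h1 : S.flow 0 v = v := hv'.1
      have h2 : S.flow 0 w = w := hw'.1
      simp only [h1, h2, dist_eq_norm, le_refl]) t ⟨ht, le_rfl⟩
  simpa [dist_eq_norm] using this

theorem TrappingBall.continuousOn_flow (hS : S.TrappingBall R δ) (hR : 0 < R) (hδ : 0 < δ)
    {t : ℝ} (ht : 0 ≤ t) : ContinuousOn (S.flow t) (Metric.closedBall 0 R) := by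
  obtain ⟨K, -, hK⟩ := hS.exists_norm_flow_sub_le hR hδ
  refine (LipschitzOnWith.of_dist_le_mul (K := (Real.exp (K * t)).toNNReal)
    fun v hv w hw => ?_).continuousOn
  rw [dist_eq_norm, dist_eq_norm, Real.coe_toNNReal _ (Real.exp_pos _).le, mul_comm]
  exact hK v hv w hw t ht

/-! ### Time derivatives at time zero. -/

theorem D_zero (v : EuclideanSpace ℝ (Fin d)) : S.D 0 v = v := by
  simp only [D, iteratedDeriv_zero]
  exact (S.exists_isLocalSolution v).choose_spec.1

theorem deriv_localSolution (v : EuclideanSpace ℝ (Fin d)) :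
    deriv (S.localSolution v) =ᶠ[𝓝 0] fun t => S.field (S.localSolution v t) :=
  (S.exists_isLocalSolution v).choose_spec.2.mono fun _ ht => ht.deriv

theorem D_one (v : EuclideanSpace ℝ (Fin d)) : S.D 1 v = S.field v := by
  rw [D, iteratedDeriv_one, (S.deriv_localSolution v).eq_of_nhds]
  congr 1
  exact S.D_zero v

theorem D_two (v : EuclideanSpace ℝ (Fin d)) : S.D 2 v = fderiv ℝ S.field v (S.field v) := by
  have h0 : S.localSolution v 0 = v := (S.exists_isLocalSolution v).choose_spec.1
  have hd : HasDerivAt (S.localSolution v) (S.field v) 0 := by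
    have := (S.exists_isLocalSolution v).choose_spec.2.self_of_nhds
    rwa [(S.exists_isLocalSolution v).choose_spec.1] at this
  rw [D, iteratedDeriv_succ, iteratedDeriv_one, (S.deriv_localSolution v).deriv_eq]
  have hF : HasFDerivAt S.field (fderiv ℝ S.field v) (S.localSolution v 0) := by
    rw [h0]
    exact (S.contDiff_field.differentiable one_ne_zero v).hasFDerivAt
  exact (hF.comp_hasDerivAt (0 : ℝ) hd).deriv

end ObservedSystem

/-! ### Lorenz '63: the observed derivatives determine the state. -/

namespace lorenz63

open ObservedSystem

variable {a b r R δ : ℝ}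

theorem field_zero (v : EuclideanSpace ℝ (Fin 3)) :
    (lorenz63 a b r).field v 0 = a * (v 1 - v 0) := by
  simp [field, lorenz63, lorenz63B, Matrix.toLpLin_apply, dotProduct,
    Fin.sum_univ_three]
  ring

theorem field_one (v : EuclideanSpace ℝ (Fin 3)) :
    (lorenz63 a b r).field v 1 = -(a * v 0) - v 1 - v 0 * v 2 := by
  simp [field, lorenz63, lorenz63B, Matrix.toLpLin_apply, dotProduct,
    Fin.sum_univ_three]
  ring

theorem H_apply (v : EuclideanSpace ℝ (Fin 3)) : (lorenz63 a b r).H v = !₂[v 0, 0, 0] := by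
  ext i
  fin_cases i <;>
    simp [lorenz63, Matrix.toLpLin_apply, dotProduct, Fin.sum_univ_three]

theorem H_apply_zero (v : EuclideanSpace ℝ (Fin 3)) : (lorenz63 a b r).H v 0 = v 0 := by
  simp [H_apply]

theorem H_eq_iff {v w : EuclideanSpace ℝ (Fin 3)} :
    (lorenz63 a b r).H v = (lorenz63 a b r).H w ↔ v 0 = w 0 := by
  refine ⟨fun h => ?_, fun h => by simp [H_apply, h]⟩
  rw [← H_apply_zero (a := a) (b := b) (r := r) v, h, H_apply_zero]

theorem abs_sub_le_norm_H_sub (v w : EuclideanSpace ℝ (Fin 3)) :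
    |v 0 - w 0| ≤ ‖(lorenz63 a b r).H v - (lorenz63 a b r).H w‖ := by
  have h := PiLp.norm_apply_le ((lorenz63 a b r).H v - (lorenz63 a b r).H w) 0
  simpa [H_apply] using h

/-- The second time derivative of the observed coordinate along the flow. -/
noncomputable def accel (a : ℝ) (v : EuclideanSpace ℝ (Fin 3)) : ℝ :=
  a * (-(a * v 0) - v 1 - v 0 * v 2 - a * (v 1 - v 0))

/-- The `i`-th coordinate of a state, as a continuous linear functional. -/
noncomputable abbrev coord (i : Fin 3) : EuclideanSpace ℝ (Fin 3) →L[ℝ] ℝ := EuclideanSpace.proj i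

theorem D_zero_apply (v : EuclideanSpace ℝ (Fin 3)) : (lorenz63 a b r).D 0 v 0 = v 0 := by
  rw [D_zero]

theorem D_one_apply (v : EuclideanSpace ℝ (Fin 3)) :
    (lorenz63 a b r).D 1 v 0 = a * (v 1 - v 0) := by
  rw [D_one, field_zero]

theorem D_two_apply (v : EuclideanSpace ℝ (Fin 3)) : (lorenz63 a b r).D 2 v 0 = accel a v := by
  have h1 : HasFDerivAt (fun w => (lorenz63 a b r).field w 0)
      ((coord 0).comp (fderiv ℝ (lorenz63 a b r).field v)) v :=
    (coord 0).hasFDerivAt.comp v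
      ((lorenz63 a b r).contDiff_field.differentiable one_ne_zero v).hasFDerivAt
  -- Coordinate `0` of the field is linear, so uniqueness of the derivative gives the needed row of
  -- the Jacobian without computing the rest.
  have h2 : HasFDerivAt (fun w => (lorenz63 a b r).field w 0)
      (a • (coord 1 - coord 0)) v := by
    have : (fun w => (lorenz63 a b r).field w 0) =
        ⇑(a • (coord 1 - coord 0)) := by
      ext w
      simp [field_zero]
    rw [this]
    exact ContinuousLinearMap.hasFDerivAt _
  have h3 := DFunLike.congr_fun (h1.unique h2) ((lorenz63 a b r).field v)
  rw [D_two]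
  refine Eq.trans h3 ?_
  simp [field_zero, field_one, accel]

theorem norm_le_abs_add_abs_add_abs (v : EuclideanSpace ℝ (Fin 3)) :
    ‖v‖ ≤ |v 0| + |v 1| + |v 2| := by
  rw [EuclideanSpace.norm_eq, Fin.sum_univ_three]
  refine Real.sqrt_le_iff.2 ⟨by positivity, ?_⟩
  simp only [Real.norm_eq_abs]
  nlinarith [abs_nonneg (v 0), abs_nonneg (v 1), abs_nonneg (v 2),
    mul_nonneg (abs_nonneg (v 0)) (abs_nonneg (v 1)),
    mul_nonneg (abs_nonneg (v 0)) (abs_nonneg (v 2)),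
    mul_nonneg (abs_nonneg (v 1)) (abs_nonneg (v 2))]

/-- The observed coordinate and its first two time derivatives determine the state. -/
theorem norm_sub_le_of_derivatives (ha : 0 < a) {u : EuclideanSpace ℝ (Fin 3)} (hu : u 0 ≠ 0) :
    ∃ c : ℝ, 0 ≤ c ∧ ∀ v ∈ Metric.closedBall (0 : EuclideanSpace ℝ (Fin 3)) R,
      ‖v - u‖ ≤ c * (|v 0 - u 0| + |a * (v 1 - v 0) - a * (u 1 - u 0)| +
        |accel a v - accel a u|) := by
  rcases lt_or_ge R 0 with hR | hR
  · exact ⟨0, le_rfl, fun v hv => by simp [Metric.closedBall_eq_empty.2 hR] at hv⟩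
  have hu' : 0 < |u 0| := abs_pos.2 hu
  refine ⟨2 + 1 / a + (R + 2 / a + a + 2) / |u 0|, by positivity, fun v hv => ?_⟩
  set d0 := v 0 - u 0 with hd0
  set d1 := a * (v 1 - v 0) - a * (u 1 - u 0) with hd1
  set d2 := accel a v - accel a u with hd2
  have hv2 : |v 2| ≤ R :=
    (PiLp.norm_apply_le v 2).trans (mem_closedBall_zero_iff.1 hv)
  have e1 : v 1 - u 1 = d0 + d1 / a := by
    rw [hd0, hd1]; field_simp; ring
  -- Splitting `v 0 * v 2 - u 0 * u 2 = d0 * v 2 + u 0 * (v 2 - u 2)` puts the known nonzero factor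
  -- `u 0` on the unknown; the other product is linear in `d0` since `|v 2| ≤ R`.
  have e2 : u 0 * (v 2 - u 2) = -(d0 * v 2) - d2 / a - a * d0 - (d0 + d1 / a) - d1 := by
    rw [hd0, hd1, hd2, accel, accel]; field_simp; ring
  have b1 : |v 1 - u 1| ≤ |d0| + |d1| / a := by
    rw [e1]
    refine (abs_add_le _ _).trans_eq ?_
    rw [abs_div, abs_of_pos ha]
  have b2 : |u 0| * |v 2 - u 2| ≤ (R + 2 / a + a + 2) * (|d0| + |d1| + |d2|) := by
    rw [← abs_mul, e2]
    have t1 : |d0 * v 2| ≤ |d0| * R := by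
      rw [abs_mul]; exact mul_le_mul_of_nonneg_left hv2 (abs_nonneg _)
    have t2 : |d2 / a| = 1 / a * |d2| := by rw [abs_div, abs_of_pos ha]; ring
    have t3 : |a * d0| = a * |d0| := by rw [abs_mul, abs_of_pos ha]
    have t4 : |d1 / a| = 1 / a * |d1| := by rw [abs_div, abs_of_pos ha]; ring
    have key : |-(d0 * v 2) - d2 / a - a * d0 - (d0 + d1 / a) - d1| ≤
        |d0 * v 2| + |d2 / a| + |a * d0| + (|d0| + |d1 / a|) + |d1| := by
      refine (abs_sub _ _).trans (add_le_add_left ?_ _)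
      refine (abs_sub _ _).trans (add_le_add ?_ (abs_add_le _ _))
      refine (abs_sub _ _).trans (add_le_add_left ?_ _)
      refine (abs_sub _ _).trans (add_le_add_left ?_ _)
      rw [abs_neg]
    rw [t2, t3, t4] at key
    have hia : 0 < 1 / a := by positivity
    rw [show 2 / a = 2 * (1 / a) by ring]
    generalize 1 / a = ia at *
    nlinarith [abs_nonneg d0, abs_nonneg d1, abs_nonneg d2, mul_nonneg hR (abs_nonneg d1),
      mul_nonneg hR (abs_nonneg d2), mul_nonneg ha.le (abs_nonneg d1),
      mul_nonneg ha.le (abs_nonneg d2), mul_nonneg hia.le (abs_nonneg d0),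
      mul_nonneg hia.le (abs_nonneg d1), mul_nonneg hia.le (abs_nonneg d2)]
  have b3 : |v 2 - u 2| ≤ (R + 2 / a + a + 2) / |u 0| * (|d0| + |d1| + |d2|) := by
    rw [div_mul_eq_mul_div, le_div_iff₀ hu', mul_comm]
    exact b2
  have b4 : |d0| + (|d0| + |d1| / a) ≤ (2 + 1 / a) * (|d0| + |d1| + |d2|) := by
    have hia : 0 < 1 / a := by positivity
    rw [show |d1| / a = 1 / a * |d1| by ring]
    generalize 1 / a = ia at *
    nlinarith [abs_nonneg d0, abs_nonneg d1, abs_nonneg d2, mul_nonneg hia.le (abs_nonneg d0),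
      mul_nonneg hia.le (abs_nonneg d2)]
  have := norm_le_abs_add_abs_add_abs (v - u)
  simp only [PiLp.sub_apply] at this
  rw [add_mul]
  linarith

theorem inner_gradient_eq {f : EuclideanSpace ℝ (Fin 3) → ℝ} {u x : EuclideanSpace ℝ (Fin 3)}
    {f' : EuclideanSpace ℝ (Fin 3) →L[ℝ] ℝ} (hf : HasFDerivAt f f' u) :
    inner ℝ (gradient f u) x = f' x := by
  rw [gradient, InnerProductSpace.toDual_symm_apply, hf.fderiv]

theorem derivativeAssumption (ha : 0 < a) {u : EuclideanSpace ℝ (Fin 3)} (hu : u 0 ≠ 0)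
    (huR : ‖u‖ < R) {j : ℕ} (hj : 2 ≤ j) : (lorenz63 a b r).DerivativeAssumption R u j := by
  refine ⟨huR, fun v hv h => ?_, ?_⟩
  · have h0 := H_eq_iff.1 (h 0 (by lia))
    have h1 := H_eq_iff.1 (h 1 (by lia))
    have h2 := H_eq_iff.1 (h 2 hj)
    rw [D_zero_apply, D_zero_apply] at h0
    rw [D_one_apply, D_one_apply] at h1
    rw [D_two_apply, D_two_apply] at h2
    obtain ⟨c, -, hc⟩ := norm_sub_le_of_derivatives (R := R) ha hu
    have := hc v hv
    rw [← h1, ← h2, ← h0] at this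
    simpa [sub_eq_zero] using this
  -- A vector orthogonal to all gradients is killed by the derivatives of orders `0, 1, 2`. This is
  -- a triangular system with diagonal `1, a, -a * u 0`, so the vector vanishes.
  · rw [← Submodule.orthogonal_eq_bot_iff, Submodule.eq_bot_iff]
    intro x hx
    have key : ∀ i ≤ j, ∀ f' : EuclideanSpace ℝ (Fin 3) →L[ℝ] ℝ,
        HasFDerivAt (fun w => (lorenz63 a b r).D i w 0) f' u → f' x = 0 := by
      intro i hi f' hf
      have hf2 : HasFDerivAt (fun w => (lorenz63 a b r).H ((lorenz63 a b r).D i w) 0) f' u := by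
        simpa only [H_apply_zero] using hf
      rw [← inner_gradient_eq hf2]
      exact (Submodule.mem_orthogonal _ _).1 hx _ (Submodule.subset_span ⟨i, hi, 0, rfl⟩)
    have hp (i : Fin 3) : HasFDerivAt (fun w : EuclideanSpace ℝ (Fin 3) => w i) (coord i) u :=
      (coord i).hasFDerivAt
    have h0 : x 0 = 0 := by
      have := key 0 (by lia) (coord 0) (by simpa only [D_zero_apply] using hp 0)
      simpa using this
    have h1 : x 1 = 0 := by
      have := key 1 (by lia) _
        (by simp only [D_one_apply]; exact ((hp 1).sub (hp 0)).const_mul a)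
      simpa [h0, ha.ne'] using this
    have h2 : x 2 = 0 := by
      have := key 2 hj _
        (by simp only [D_two_apply, accel]; exact (((((hp 0).const_mul a).neg.sub (hp 1)).sub
          ((hp 0).mul (hp 2))).sub (((hp 1).sub (hp 0)).const_mul a)).const_mul a)
      simpa [h0, h1, ha.ne', hu] using this
    ext i
    fin_cases i <;> simp [h0, h1, h2]

end lorenz63

/-! ### Measurable selection of minimisers. -/

theorem measurable_iInf_of_continuous {X T : Type*} [MeasurableSpace X] [TopologicalSpace T]
    [CompactSpace T] [TopologicalSpace.SeparableSpace T] [Nonempty T] {J : X → T → ℝ}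
    (hm : ∀ t, Measurable fun x => J x t) (hc : ∀ x, Continuous (J x)) :
    Measurable fun x => ⨅ t, J x t := by
  have h : ∀ x, ⨅ t, J x t = ⨅ n, J x (TopologicalSpace.denseSeq T n) := by
    intro x
    have hb : BddBelow (range (J x)) := (isCompact_range (hc x)).bddBelow
    refine le_antisymm (le_ciInf fun n => ciInf_le hb _) (le_ciInf fun t => ?_)
    have hb' : BddBelow (range fun n => J x (TopologicalSpace.denseSeq T n)) :=
      hb.mono (range_comp_subset_range _ _)
    exact (TopologicalSpace.denseRange_denseSeq T).induction_on
      (p := fun t => ⨅ n, J x (TopologicalSpace.denseSeq T n) ≤ J x t) t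
      (isClosed_le continuous_const (hc x)) fun n => ciInf_le hb' n
  simp_rw [h]
  exact Measurable.iInf fun n => hm _

/-- Measurable selection of the least minimiser over a compact set of reals. -/
theorem exists_measurable_argmin_real {X : Type*} [MeasurableSpace X] {C : Set ℝ}
    (hC : IsCompact C) (hne : C.Nonempty) {J : X → C → ℝ}
    (hm : ∀ t, Measurable fun x => J x t) (hc : ∀ x, Continuous (J x)) :
    ∃ U : X → C, Measurable U ∧ ∀ x t, J x (U x) ≤ J x t := by
  have hCs : CompactSpace C := isCompact_iff_compactSpace.1 hC
  have hCn : Nonempty C := hne.to_subtype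
  have hmin : ∀ x, ∃ t, IsLeast {t | ∀ s, J x t ≤ J x s} t := by
    intro x
    have hcl : IsClosed {t | ∀ s, J x t ≤ J x s} := by
      simp only [Set.ofPred_forall]
      exact isClosed_iInter fun s => isClosed_le (hc x) continuous_const
    obtain ⟨t, -, ht⟩ := isCompact_univ.exists_isMinOn univ_nonempty (hc x).continuousOn
    exact hcl.isCompact.exists_isLeast ⟨t, fun s => ht (mem_univ s)⟩
  choose U hU using hmin
  refine ⟨U, Measurable.subtype_mk (f := fun x => (U x : ℝ)) ?_, fun x => (hU x).1⟩
  refine measurable_of_Iic fun s => ?_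
  rcases isEmpty_or_nonempty {t : C // (t : ℝ) ≤ s} with he | he
  · convert MeasurableSet.empty
    ext x
    simp only [mem_preimage, mem_Iic, mem_empty_iff_false, iff_false]
    exact fun hx => he.false ⟨U x, hx⟩
  · have hT : CompactSpace {t : C // (t : ℝ) ≤ s} :=
      isCompact_iff_compactSpace.1
        (isClosed_le continuous_subtype_val continuous_const).isCompact
    -- The least minimiser is at most `s` exactly when the infimum over parameters `≤ s` already
    -- attains the full infimum; both infima are measurable.
    have hset : (fun x => (U x : ℝ)) ⁻¹' Iic s =
        {x | ⨅ t : {t : C // (t : ℝ) ≤ s}, J x t ≤ ⨅ t, J x t} := by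
      ext x
      have hb : BddBelow (range (J x)) := (isCompact_range (hc x)).bddBelow
      have hcT : Continuous fun t : {t : C // (t : ℝ) ≤ s} => J x t :=
        (hc x).comp continuous_subtype_val
      have hbT : BddBelow (range fun t : {t : C // (t : ℝ) ≤ s} => J x t) :=
        (isCompact_range hcT).bddBelow
      simp only [mem_preimage, mem_Iic, mem_ofPred_eq]
      constructor
      · exact fun hx => (ciInf_le hbT ⟨U x, hx⟩).trans (le_ciInf (hU x).1)
      · intro hx
        obtain ⟨t, -, ht⟩ := isCompact_univ.exists_isMinOn univ_nonempty hcT.continuousOn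
        have h1 : ∀ r, J x t ≤ J x r := fun r =>
          ((le_ciInf fun y => ht (mem_univ y)).trans hx).trans (ciInf_le hb r)
        exact le_trans ((hU x).2 h1) t.2
    rw [hset]
    exact measurableSet_le
      (measurable_iInf_of_continuous (fun t => hm t) fun x => (hc x).comp continuous_subtype_val)
      (measurable_iInf_of_continuous hm hc)

/-- Measurable selection of a minimiser over a compact metric space. -/
theorem exists_measurable_argmin {X K : Type*} [MeasurableSpace X] [MetricSpace K]
    [CompactSpace K] [Nonempty K] [MeasurableSpace K] [BorelSpace K] {J : X → K → ℝ}
    (hm : ∀ v, Measurable fun x => J x v) (hc : ∀ x, Continuous (J x)) :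
    ∃ U : X → K, Measurable U ∧ ∀ x v, J x (U x) ≤ J x v := by
  -- A compact metric space is a continuous image of the Cantor set, so the order on the reals can
  -- choose the minimiser there.
  obtain ⟨f, hf, hsurj⟩ := exists_nat_bool_continuous_surjective_of_compact K
  let φ : cantorSet → K := f ∘ cantorSetHomeomorphNatToBool
  have hφ : Continuous φ := hf.comp (map_continuous _)
  have hφs : Function.Surjective φ := hsurj.comp cantorSetHomeomorphNatToBool.surjective
  obtain ⟨U, hU, hmin⟩ := exists_measurable_argmin_real isCompact_cantorSet
    ⟨0, zero_mem_cantorSet⟩ (J := fun x t => J x (φ t)) (fun t => hm _) fun x => (hc x).comp hφ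
  refine ⟨φ ∘ U, hφ.measurable.comp hU, fun x v => ?_⟩
  obtain ⟨t, rfl⟩ := hφs v
  exact hmin x t

/-! ### Taylor expansion and discrete observability. -/

/-- A second order Taylor bound at the left end point of `[0, T]`. -/
theorem abs_taylor_two_le {g g1 g2 : ℝ → ℝ} {T N : ℝ} (hT : 0 ≤ T)
    (hg : ∀ t, 0 ≤ t → HasDerivWithinAt g (g1 t) (Ici 0) t)
    (hg1 : ∀ t, 0 ≤ t → HasDerivWithinAt g1 (g2 t) (Ici 0) t)
    (hN : ∀ t ∈ Icc 0 T, |g2 t - g2 0| ≤ N) :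
    |g T - g 0 - T * g1 0 - T ^ 2 / 2 * g2 0| ≤ N * T * T := by
  have hN0 : 0 ≤ N := (abs_nonneg _).trans (hN 0 ⟨le_rfl, hT⟩)
  have hlin : ∀ c s : ℝ, HasDerivWithinAt (fun t => t * c) c (Icc 0 T) s := fun c s => by
    simpa only [id, one_mul] using (hasDerivWithinAt_id s (Icc 0 T)).mul_const c
  have hsq : ∀ c s : ℝ, HasDerivWithinAt (fun t => t ^ 2 / 2 * c) (s * c) (Icc 0 T) s :=
    fun c s => by
      have h := (((hasDerivAt_pow 2 s).div_const 2).mul_const c).hasDerivWithinAt (s := Icc 0 T)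
      rwa [show ((2 : ℕ) : ℝ) * s ^ (2 - 1) / 2 * c = s * c by norm_num] at h
  have h1 : ∀ t ∈ Icc 0 T, |g1 t - g1 0 - t * g2 0| ≤ N * T := by
    intro t ht
    have := (convex_Icc 0 T).norm_image_sub_le_of_norm_hasDerivWithin_le
      (f := fun t => g1 t - t * g2 0) (f' := fun t => g2 t - g2 0) (C := N) (x := 0) (y := t)
      (fun s hs => ((hg1 s hs.1).mono Icc_subset_Ici_self).sub (hlin _ s)) hN ⟨le_rfl, hT⟩ ht
    simp only [Real.norm_eq_abs, zero_mul, sub_zero, abs_of_nonneg ht.1] at this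
    rw [show g1 t - g1 0 - t * g2 0 = g1 t - t * g2 0 - g1 0 by ring]
    exact this.trans (mul_le_mul_of_nonneg_left ht.2 hN0)
  have := (convex_Icc 0 T).norm_image_sub_le_of_norm_hasDerivWithin_le
    (f := fun t => g t - t * g1 0 - t ^ 2 / 2 * g2 0)
    (f' := fun t => g1 t - g1 0 - t * g2 0) (C := N * T) (x := 0) (y := T)
    (fun s hs => (((hg s hs.1).mono Icc_subset_Ici_self).sub (hlin _ s)).sub (hsq _ s)) h1
    ⟨le_rfl, hT⟩
      ⟨hT, le_rfl⟩
  simp only [Real.norm_eq_abs, sub_zero, abs_of_nonneg hT] at this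
  convert this using 2
  ring

namespace lorenz63

open ObservedSystem

variable {a b r R δ : ℝ}

/-- The third time derivative of the observed coordinate along the flow. -/
noncomputable def jerk (a b r : ℝ) (v : EuclideanSpace ℝ (Fin 3)) : ℝ :=
  a * (-(a * (lorenz63 a b r).field v 0) - (lorenz63 a b r).field v 1 -
    ((lorenz63 a b r).field v 0 * v 2 + v 0 * (lorenz63 a b r).field v 2) -
    a * ((lorenz63 a b r).field v 1 - (lorenz63 a b r).field v 0))

theorem exists_lipschitz_jerk (a b r R : ℝ) : ∃ L : ℝ, 0 ≤ L ∧
    ∀ v ∈ Metric.closedBall (0 : EuclideanSpace ℝ (Fin 3)) R,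
    ∀ w ∈ Metric.closedBall (0 : EuclideanSpace ℝ (Fin 3)) R,
      |jerk a b r v - jerk a b r w| ≤ L * ‖v - w‖ := by
  have hF (i : Fin 3) : ContDiff ℝ 1 fun v => (lorenz63 a b r).field v i :=
    (coord i).contDiff.comp (lorenz63 a b r).contDiff_field
  have hp (i : Fin 3) : ContDiff ℝ 1 fun v : EuclideanSpace ℝ (Fin 3) => v i := (coord i).contDiff
  have hj : ContDiff ℝ 1 (jerk a b r) := by
    unfold jerk
    exact contDiff_const.mul ((((contDiff_const.mul (hF 0)).neg.sub (hF 1)).sub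
      (((hF 0).mul (hp 2)).add ((hp 0).mul (hF 2)))).sub (contDiff_const.mul ((hF 1).sub (hF 0))))
  obtain ⟨L, hL⟩ := hj.locallyLipschitz.locallyLipschitzOn.exists_lipschitzOnWith_of_compact
    (isCompact_closedBall (0 : EuclideanSpace ℝ (Fin 3)) R)
  refine ⟨L, L.2, fun v hv w hw => ?_⟩
  simpa [dist_eq_norm] using hL.dist_le_mul v hv w hw

section Derivatives

variable {v : EuclideanSpace ℝ (Fin 3)} {γ : ℝ → EuclideanSpace ℝ (Fin 3)}

theorem hasDerivWithinAt_coord (hγ : (lorenz63 a b r).IsForwardSolution v γ) (i : Fin 3) {t : ℝ}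
    (ht : 0 ≤ t) : HasDerivWithinAt (fun t => γ t i) ((lorenz63 a b r).field (γ t) i) (Ici 0) t :=
  (coord i).hasFDerivAt.comp_hasDerivWithinAt t (hγ.2 t ht)

theorem hasDerivWithinAt_velocity (hγ : (lorenz63 a b r).IsForwardSolution v γ) {t : ℝ}
    (ht : 0 ≤ t) :
    HasDerivWithinAt (fun t => a * (γ t 1 - γ t 0)) (accel a (γ t)) (Ici 0) t := by
  have := ((hasDerivWithinAt_coord hγ 1 ht).sub (hasDerivWithinAt_coord hγ 0 ht)).const_mul a
  rwa [field_zero, field_one] at this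

theorem hasDerivWithinAt_accel (hγ : (lorenz63 a b r).IsForwardSolution v γ) {t : ℝ}
    (ht : 0 ≤ t) :
    HasDerivWithinAt (fun t => accel a (γ t)) (jerk a b r (γ t)) (Ici 0) t := by
  have h0 := hasDerivWithinAt_coord hγ 0 ht
  have h1 := hasDerivWithinAt_coord hγ 1 ht
  have h2 := hasDerivWithinAt_coord hγ 2 ht
  exact ((((h0.const_mul a).neg.sub h1).sub (h0.mul h2)).sub ((h1.sub h0).const_mul a)).const_mul a

end Derivatives

/-- The second order Taylor remainder of the observed coordinate is Lipschitz in the initial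
point. -/
theorem exists_abs_taylor_sub_le (hS : (lorenz63 a b r).TrappingBall R δ) (hR : 0 < R)
    (hδ : 0 < δ) : ∃ M : ℝ, 0 ≤ M ∧
      ∀ v ∈ Metric.closedBall (0 : EuclideanSpace ℝ (Fin 3)) R,
      ∀ u ∈ Metric.closedBall (0 : EuclideanSpace ℝ (Fin 3)) R, ∀ T ∈ Icc (0 : ℝ) 2,
        |((lorenz63 a b r).flow T v 0 - (lorenz63 a b r).flow T u 0) - (v 0 - u 0) -
          T * (a * (v 1 - v 0) - a * (u 1 - u 0)) - T ^ 2 / 2 * (accel a v - accel a u)| ≤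
          M * T ^ 3 * ‖v - u‖ := by
  obtain ⟨K, hK0, hK⟩ := hS.exists_norm_flow_sub_le hR hδ
  obtain ⟨L, hL0, hL⟩ := exists_lipschitz_jerk a b r R
  refine ⟨L * Real.exp (K * 2), by positivity, fun v hv u hu T hT => ?_⟩
  have hγv := hS.isForwardSolution_flow hR hδ hv
  have hγu := hS.isForwardSolution_flow hR hδ hu
  have hv0 : (lorenz63 a b r).flow 0 v = v := hγv.1
  have hu0 : (lorenz63 a b r).flow 0 u = u := hγu.1
  -- The difference of accelerations has the difference of jerks as derivative, which is bounded by
  -- the current distance, hence by `‖v - u‖`. This supplies the factor `‖v - u‖` in the remainder.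
  have hN : ∀ t ∈ Icc 0 T, |(accel a ((lorenz63 a b r).flow t v) -
      accel a ((lorenz63 a b r).flow t u)) - (accel a ((lorenz63 a b r).flow 0 v) -
      accel a ((lorenz63 a b r).flow 0 u))| ≤ L * Real.exp (K * 2) * ‖v - u‖ * T := by
    intro t ht
    have := (convex_Icc 0 T).norm_image_sub_le_of_norm_hasDerivWithin_le
      (f := fun t => accel a ((lorenz63 a b r).flow t v) - accel a ((lorenz63 a b r).flow t u))
      (f' := fun t => jerk a b r ((lorenz63 a b r).flow t v) -
        jerk a b r ((lorenz63 a b r).flow t u))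
      (C := L * Real.exp (K * 2) * ‖v - u‖) (x := 0) (y := t)
      (fun s hs => ((hasDerivWithinAt_accel hγv hs.1).sub
        (hasDerivWithinAt_accel hγu hs.1)).mono Icc_subset_Ici_self)
      (fun s hs => ?_) ⟨le_rfl, hT.1⟩ ht
    · rw [sub_zero, Real.norm_eq_abs, Real.norm_eq_abs, abs_of_nonneg ht.1] at this
      exact this.trans (mul_le_mul_of_nonneg_left ht.2 (by positivity))
    · refine (hL _ (hS.flow_mem hR hδ hv hs.1) _ (hS.flow_mem hR hδ hu hs.1)).trans ?_
      rw [mul_assoc]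
      refine mul_le_mul_of_nonneg_left ((hK v hv u hu s hs.1).trans ?_) hL0
      rw [mul_comm]
      have : s ≤ 2 := hs.2.trans hT.2
      gcongr
  have := abs_taylor_two_le hT.1
    (fun t ht => (hasDerivWithinAt_coord hγv 0 ht).sub (hasDerivWithinAt_coord hγu 0 ht))
    (g1 := fun t => (lorenz63 a b r).field ((lorenz63 a b r).flow t v) 0 -
      (lorenz63 a b r).field ((lorenz63 a b r).flow t u) 0)
    (g2 := fun t => accel a ((lorenz63 a b r).flow t v) - accel a ((lorenz63 a b r).flow t u))
    (fun t ht => by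
      simp only [field_zero]
      exact (hasDerivWithinAt_velocity hγv ht).sub (hasDerivWithinAt_velocity hγu ht)) hN
  simp only [field_zero, Pi.sub_apply, hv0, hu0] at this
  refine this.trans_eq ?_
  ring

/-- Observability: three consecutive observations with a small time step determine the initial
point, in a Lipschitz way. -/
theorem exists_norm_sub_le_of_observations (ha : 0 < a) (hS : (lorenz63 a b r).TrappingBall R δ)
    (hR : 0 < R) (hδ : 0 < δ) {u : EuclideanSpace ℝ (Fin 3)} (hu : u ∈ Metric.closedBall 0 R)
    (hu0 : u 0 ≠ 0) :
    ∃ h₀ : ℝ, 0 < h₀ ∧ ∀ h : ℝ, 0 < h → h < h₀ → ∃ C : ℝ, 0 ≤ C ∧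
      ∀ v ∈ Metric.closedBall (0 : EuclideanSpace ℝ (Fin 3)) R, ∀ ρ : ℝ,
        (∀ i : ℕ, i ≤ 2 →
          |(lorenz63 a b r).flow (i * h) v 0 - (lorenz63 a b r).flow (i * h) u 0| ≤ ρ) →
        ‖v - u‖ ≤ C * ρ := by
  obtain ⟨M, hM0, hM⟩ := exists_abs_taylor_sub_le hS hR hδ
  obtain ⟨c, hc0, hc⟩ := norm_sub_le_of_derivatives (R := R) ha hu0
  -- The bound `1` keeps `2 * h` in the Taylor range `[0, 2]`; the other makes the total error `16 *
  -- c * M * h` at most `1 / 2`. The `+ 1` avoids division by zero.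
  refine ⟨min 1 (1 / (32 * (c * M + 1))), by positivity, fun h hh hlt => ?_⟩
  have hh1 : h < 1 := hlt.trans_le (min_le_left _ _)
  have hh2 : 32 * (c * M) * h ≤ 1 := by
    have h1 := hlt.le.trans (min_le_right _ _)
    rw [le_div_iff₀ (by positivity)] at h1
    linarith
  refine ⟨2 * c * (1 + 4 / h + 4 / h ^ 2), by positivity, fun v hv ρ hρ => ?_⟩
  have hγv : (lorenz63 a b r).flow 0 v = v := (hS.isForwardSolution_flow hR hδ hv).1
  have hγu : (lorenz63 a b r).flow 0 u = u := (hS.isForwardSolution_flow hR hδ hu).1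
  have r0 := hρ 0 (by lia)
  have r1 := hρ 1 (by lia)
  have r2 := hρ 2 le_rfl
  have T1 := hM v hv u hu h ⟨hh.le, by linarith⟩
  have T2 := hM v hv u hu (2 * h) ⟨by positivity, by linarith⟩
  have main := hc v hv
  simp only [Nat.cast_zero, zero_mul, Nat.cast_one, one_mul, Nat.cast_ofNat, hγv, hγu] at r0 r1 r2
  set e := ‖v - u‖
  have he : 0 ≤ e := norm_nonneg _
  generalize v 0 - u 0 = d0 at *
  generalize a * (v 1 - v 0) - a * (u 1 - u 0) = d1 at *
  generalize accel a v - accel a u = d2 at *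
  generalize (lorenz63 a b r).flow h v 0 - (lorenz63 a b r).flow h u 0 = g1 at *
  generalize (lorenz63 a b r).flow (2 * h) v 0 - (lorenz63 a b r).flow (2 * h) u 0 = g2 at *
  rw [abs_le] at r0 r1 r2 T1 T2
  -- Second difference `g2 - 2 * g1 + d0`: the remainders add up to `(8 + 2) * M * h ^ 3 * e`.
  have B2 : |d2| ≤ 4 / h ^ 2 * ρ + 10 * M * h * e := by
    have : |h ^ 2 * d2| ≤ h ^ 2 * (4 / h ^ 2 * ρ + 10 * M * h * e) := by
      rw [show h ^ 2 * (4 / h ^ 2 * ρ + 10 * M * h * e) = 4 * ρ + 10 * (M * h ^ 3 * e) by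
        field_simp]
      rw [abs_le]
      constructor <;> linarith
    rw [abs_mul, abs_of_pos (by positivity : (0 : ℝ) < h ^ 2)] at this
    exact le_of_mul_le_mul_left this (by positivity)
  -- The combination `4 * g1 - g2 - 3 * d0` cancels `d2` and leaves `2 * h * d1`; `h ≤ 1` weakens
  -- the remainder to the order needed.
  have B1 : |d1| ≤ 4 / h * ρ + 6 * M * h * e := by
    have : |h * d1| ≤ h * (4 / h * ρ + 6 * M * h * e) := by
      have hcube : M * h ^ 3 * e ≤ M * h ^ 2 * e := by
        have : h ^ 3 ≤ h ^ 2 := pow_le_pow_of_le_one hh.le hh1.le (by lia)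
        gcongr
      rw [show h * (4 / h * ρ + 6 * M * h * e) = 4 * ρ + 6 * (M * h ^ 2 * e) by
        field_simp]
      rw [abs_le]
      constructor <;> linarith
    rw [abs_mul, abs_of_pos hh] at this
    exact le_of_mul_le_mul_left this hh
  have B0 : |d0| ≤ ρ := abs_le.2 r0
  have hsum : e ≤ c * (1 + 4 / h + 4 / h ^ 2) * ρ + (16 * (c * M) * h) * e := by
    calc e ≤ c * (|d0| + |d1| + |d2|) := main
      _ ≤ c * (ρ + (4 / h * ρ + 6 * M * h * e) + (4 / h ^ 2 * ρ + 10 * M * h * e)) := by gcongr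
      _ = _ := by ring
  have : (16 * (c * M) * h) * e ≤ 1 / 2 * e := by
    gcongr
    linarith
  linarith

end lorenz63

/-! ### Second moments of the noise. -/

namespace IsObservationNoise

variable {Ω : Type*} [MeasurableSpace Ω] {P : Measure Ω} {m : ℕ}
  {η : EuclideanSpace ℝ (Fin m) → ℝ≥0∞} {Z : ℕ → Ω → EuclideanSpace ℝ (Fin m)}

theorem identDistrib_norm_sq (hZ : IsObservationNoise P η Z) (i : ℕ) :
    IdentDistrib (fun ω => ‖Z i ω‖ ^ 2) (fun ω => ‖Z 0 ω‖ ^ 2) P P := by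
  have h : IdentDistrib (Z i) (Z 0) P P :=
    ⟨(hZ.measurable i).aemeasurable, (hZ.measurable 0).aemeasurable,
      (hZ.map_eq i).trans (hZ.map_eq 0).symm⟩
  exact h.comp (measurable_norm.pow_const 2)

theorem integrable_sum_norm_sq (hZ : IsObservationNoise P η Z)
    (h2 : Integrable (fun ω => ‖Z 0 ω‖ ^ 2) P) (n : ℕ) :
    Integrable (fun ω => ∑ i : Fin n, ‖Z i ω‖ ^ 2) P :=
  integrable_finsetSum _ fun i _ => (hZ.identDistrib_norm_sq i).integrable_iff.2 h2

theorem integral_sum_norm_sq (hZ : IsObservationNoise P η Z)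
    (h2 : Integrable (fun ω => ‖Z 0 ω‖ ^ 2) P) (n : ℕ) :
    ∫ ω, ∑ i : Fin n, ‖Z i ω‖ ^ 2 ∂P = n * ∫ ω, ‖Z 0 ω‖ ^ 2 ∂P := by
  rw [integral_finsetSum _ fun (i : Fin n) _ => (hZ.identDistrib_norm_sq i).integrable_iff.2 h2]
  simp [fun i : Fin n => (hZ.identDistrib_norm_sq i).integral_eq]

/-- An error dominated by the total squared noise has mean square at most a multiple of the
variance. -/
theorem integrable_and_integral_le (hZ : IsObservationNoise P η Z)
    (h2 : Integrable (fun ω => ‖Z 0 ω‖ ^ 2) P) {n : ℕ} {f : Ω → ℝ} (hf : Measurable f)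
    (hf0 : ∀ ω, 0 ≤ f ω) {c : ℝ} (hfc : ∀ ω, f ω ≤ c * ∑ i : Fin n, ‖Z i ω‖ ^ 2) :
    Integrable f P ∧ ∫ ω, f ω ∂P ≤ c * n * ∫ ω, ‖Z 0 ω‖ ^ 2 ∂P := by
  have hint := (hZ.integrable_sum_norm_sq h2 n).const_mul c
  have hfi : Integrable f P := hint.mono' hf.aestronglyMeasurable
    (Eventually.of_forall fun ω => by rw [Real.norm_of_nonneg (hf0 ω)]; exact hfc ω)
  refine ⟨hfi, (integral_mono hfi hint hfc).trans_eq ?_⟩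
  rw [integral_const_mul, hZ.integral_sum_norm_sq h2, mul_assoc]

end IsObservationNoise

theorem Metric.ediam_le_of_forall_norm_sub_le {E : Type*} [SeminormedAddCommGroup E] {s : Set E}
    {u : E} {ρ : ℝ} (h : ∀ v ∈ s, ‖v - u‖ ≤ ρ) : Metric.ediam s ≤ ENNReal.ofReal (2 * ρ) := by
  refine Metric.ediam_le fun v hv w hw => ?_
  rw [edist_dist]
  refine ENNReal.ofReal_le_ofReal ((dist_triangle_right v w u).trans ?_)
  rw [dist_eq_norm, dist_eq_norm]
  linarith [h v hv, h w hw]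

/-! ### Supports, residuals and least squares estimators. -/

namespace ObservedSystem

variable {d m : ℕ} {S : ObservedSystem d m} {R δ : ℝ}

theorem measurable_observations {Ω : Type*} [MeasurableSpace Ω]
    {Z : ℕ → Ω → EuclideanSpace ℝ (Fin m)} (hZ : ∀ i, Measurable (Z i)) (h : ℝ) (k : ℕ)
    (u : EuclideanSpace ℝ (Fin d)) :
    Measurable fun ω => S.observations h k u fun i => Z i ω :=
  measurable_pi_lambda _ fun i => (hZ i).const_add _

/-- A zero weight gives a zero density whatever the normalising integral, even `0` or `∞`, so every
factor of the weight is nonzero. -/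
theorem mem_closedBall_of_mem_smootherSupport {h : ℝ} {k : ℕ}
    {η : EuclideanSpace ℝ (Fin m) → ℝ≥0∞} {q : EuclideanSpace ℝ (Fin d) → ℝ≥0∞}
    {Y : Fin (k + 1) → EuclideanSpace ℝ (Fin m)} {v : EuclideanSpace ℝ (Fin d)}
    (hv : v ∈ S.smootherSupport R h k η q Y) :
    v ∈ Metric.closedBall 0 R ∧ ∀ i : Fin (k + 1), η (Y i - S.H (S.flow ((i : ℕ) * h) v)) ≠ 0 := by
  have hw : S.smootherWeight R h k η q Y v ≠ 0 := fun h0 => hv (by simp [smootherDensity, h0])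
  rw [smootherWeight] at hw
  split_ifs at hw with hm
  · exact ⟨hm, fun i => Finset.prod_ne_zero_iff.1 (left_ne_zero_of_mul hw) i (Finset.mem_univ i)⟩
  · exact absurd rfl hw

/-- The witness is the preimage selected by `flowInv`; only its being a preimage in the ball
matters, and the Jacobian and prior factors are discarded. -/
theorem exists_of_mem_filterSupport {h : ℝ} {k : ℕ}
    {η : EuclideanSpace ℝ (Fin m) → ℝ≥0∞} {q : EuclideanSpace ℝ (Fin d) → ℝ≥0∞}
    {Y : Fin (k + 1) → EuclideanSpace ℝ (Fin m)} {v : EuclideanSpace ℝ (Fin d)}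
    (hv : v ∈ S.filterSupport R h k η q Y) :
    ∃ w ∈ Metric.closedBall 0 R, S.flow (k * h) w = v ∧
      ∀ i : Fin (k + 1), η (Y i - S.H (S.flow ((i : ℕ) * h) w)) ≠ 0 := by
  have hw : S.filterWeight R h k η q Y v ≠ 0 := fun h0 => hv (by simp [filterDensity, h0])
  rw [filterWeight] at hw
  split_ifs at hw with hm
  · exact ⟨S.flowInv R (k * h) v, Function.invFunOn_mem hm, Function.invFunOn_eq hm, fun i =>
      Finset.prod_ne_zero_iff.1 (left_ne_zero_of_mul (left_ne_zero_of_mul hw)) i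
        (Finset.mem_univ i)⟩
  · exact absurd rfl hw

/-- The sum of squared residuals of the initial point `v` given the observations `Y`. -/
noncomputable def residual (S : ObservedSystem d m) (h : ℝ) (k : ℕ)
    (Y : Fin (k + 1) → EuclideanSpace ℝ (Fin m)) (v : EuclideanSpace ℝ (Fin d)) : ℝ :=
  ∑ i : Fin (k + 1), ‖Y i - S.H (S.flow ((i : ℕ) * h) v)‖ ^ 2

/-- Measurable least squares estimators of the initial point and of the current state. -/
theorem TrappingBall.exists_least_squares (hS : S.TrappingBall R δ) (hR : 0 < R) (hδ : 0 < δ)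
    (h : ℝ) (k : ℕ) :
    ∃ Usm Ufi : (Fin (k + 1) → EuclideanSpace ℝ (Fin m)) → EuclideanSpace ℝ (Fin d),
      Measurable Usm ∧ Measurable Ufi ∧ (0 < h → ∀ Y, Usm Y ∈ Metric.closedBall 0 R ∧
        (∀ v ∈ Metric.closedBall (0 : EuclideanSpace ℝ (Fin d)) R,
          S.residual h k Y (Usm Y) ≤ S.residual h k Y v) ∧ Ufi Y = S.flow (k * h) (Usm Y)) := by
  -- The flow is controlled for nonnegative times only; for `h ≤ 0` the zero estimator serves as a
  -- measurable default.
  rcases le_or_gt h 0 with hh | hh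
  · exact ⟨0, 0, measurable_const, measurable_const, fun h' => absurd h' hh.not_gt⟩
  let K := Metric.closedBall (0 : EuclideanSpace ℝ (Fin d)) R
  have : CompactSpace K := isCompact_iff_compactSpace.1 (isCompact_closedBall _ _)
  have : Nonempty K := ⟨0, Metric.mem_closedBall_self hR.le⟩
  have hflow : ∀ i : ℕ, Continuous fun v : K => S.flow (i * h) v := fun i =>
    continuousOn_iff_continuous_domRestrict.1 (hS.continuousOn_flow hR hδ (by positivity))
  have hH : Continuous S.H := S.H.continuous_of_finiteDimensional
  obtain ⟨U, hU, hmin⟩ := exists_measurable_argmin (K := K)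
    (J := fun Y v => S.residual h k Y v)
    (fun v => Finset.measurable_fun_sum _ fun i _ =>
      ((measurable_pi_apply i).sub_const _).norm.pow_const 2)
    (fun Y => continuous_finsetSum _ fun i _ =>
      (continuous_const.sub (hH.comp (hflow i))).norm.pow 2)
  exact ⟨fun Y => U Y, fun Y => S.flow (k * h) (U Y), measurable_subtype_coe.comp hU,
    (hflow k).measurable.comp hU, fun _ Y => ⟨(U Y).2, fun v hv => hmin Y ⟨v, hv⟩, rfl⟩⟩

theorem residual_observations (h : ℝ) (k : ℕ) (u : EuclideanSpace ℝ (Fin d))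
    (z : ℕ → EuclideanSpace ℝ (Fin m)) :
    S.residual h k (S.observations h k u z) u = ∑ i : Fin (k + 1), ‖z i‖ ^ 2 := by
  simp [residual, observations]

/-- The residual of the true `u` is the total squared noise, so it bounds every single residual of
`v`; the triangle inequality through the observation gives the factor `2`. -/
theorem norm_H_flow_sub_le_of_residual_le {h : ℝ} {k : ℕ} {u v : EuclideanSpace ℝ (Fin d)}
    {z : ℕ → EuclideanSpace ℝ (Fin m)}
    (hv : S.residual h k (S.observations h k u z) v ≤ S.residual h k (S.observations h k u z) u)
    (i : Fin (k + 1)) :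
    ‖S.H (S.flow ((i : ℕ) * h) v) - S.H (S.flow ((i : ℕ) * h) u)‖ ≤
      2 * √(∑ i : Fin (k + 1), ‖z i‖ ^ 2) := by
  rw [residual_observations] at hv
  have h1 : ‖S.observations h k u z i - S.H (S.flow ((i : ℕ) * h) v)‖ ≤
      √(∑ i : Fin (k + 1), ‖z i‖ ^ 2) :=
    Real.le_sqrt_of_sq_le ((Finset.single_le_sum
      (f := fun i : Fin (k + 1) => ‖S.observations h k u z i - S.H (S.flow ((i : ℕ) * h) v)‖ ^ 2)
      (fun _ _ => by positivity) (Finset.mem_univ i)).trans hv)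
  have h2 : ‖z i‖ ≤ √(∑ i : Fin (k + 1), ‖z i‖ ^ 2) :=
    Real.le_sqrt_of_sq_le (Finset.single_le_sum (f := fun i : Fin (k + 1) => ‖z i‖ ^ 2)
      (fun _ _ => by positivity) (Finset.mem_univ i))
  have h3 : S.H (S.flow ((i : ℕ) * h) v) - S.H (S.flow ((i : ℕ) * h) u) =
      z i - (S.observations h k u z i - S.H (S.flow ((i : ℕ) * h) v)) := by
    simp only [observations]
    abel
  rw [h3]
  exact (norm_sub_le _ _).trans (by linarith)

theorem norm_H_flow_sub_le_of_density_ne_zero {h ε : ℝ} {k : ℕ} {u v : EuclideanSpace ℝ (Fin d)}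
    {z : ℕ → EuclideanSpace ℝ (Fin m)} {η : EuclideanSpace ℝ (Fin m) → ℝ≥0∞}
    (hη : ∀ z, ε < ‖z‖ → η z = 0) (hz : ∀ i, ‖z i‖ ≤ ε) {i : Fin (k + 1)}
    (hv : η (S.observations h k u z i - S.H (S.flow ((i : ℕ) * h) v)) ≠ 0) :
    ‖S.H (S.flow ((i : ℕ) * h) v) - S.H (S.flow ((i : ℕ) * h) u)‖ ≤ 2 * ε := by
  have h1 : ‖S.observations h k u z i - S.H (S.flow ((i : ℕ) * h) v)‖ ≤ ε :=
    not_lt.1 fun hlt => hv (hη _ hlt)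
  have h3 : S.H (S.flow ((i : ℕ) * h) v) - S.H (S.flow ((i : ℕ) * h) u) =
      z i - (S.observations h k u z i - S.H (S.flow ((i : ℕ) * h) v)) := by
    simp only [observations]
    abel
  rw [h3]
  exact (norm_sub_le _ _).trans (by linarith [hz i])

end ObservedSystem

/-! ### The exceptional null set and the main theorem. -/

theorem lorenz63.ae_coord_ne_zero_and_norm_lt (R : ℝ) :
    ∀ᵐ u : EuclideanSpace ℝ (Fin 3), u ∈ Metric.closedBall 0 R → u 0 ≠ 0 ∧ ‖u‖ < R := by
  have h1 : ∀ᵐ u : EuclideanSpace ℝ (Fin 3), u ∉ LinearMap.ker (coord 0).toLinearMap := by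
    refine measure_eq_zero_iff_ae_notMem.1 (Measure.addHaar_submodule volume _ fun htop => ?_)
    have : EuclideanSpace.single (0 : Fin 3) (1 : ℝ) ∈ LinearMap.ker (coord 0).toLinearMap :=
      htop ▸ Submodule.mem_top
    simp at this
  have h2 : ∀ᵐ u : EuclideanSpace ℝ (Fin 3), u ∉ Metric.sphere 0 R :=
    measure_eq_zero_iff_ae_notMem.1 (Measure.addHaar_sphere volume 0 R)
  filter_upwards [h1, h2] with u hu1 hu2 hu
  refine ⟨fun h0 => hu1 h0, lt_of_le_of_ne (mem_closedBall_zero_iff.1 hu) fun h0 => hu2 ?_⟩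
  simpa using h0

theorem mainTheorem11 (a b r : ℝ) (ha : 0 < a) (hb : 0 < b)
    (R δ : ℝ) (hR : 0 < R) (hδ : 0 < δ) (htrap : (lorenz63 a b r).TrappingBall R δ) :
    -- the assumption on derivatives holds at almost every initial point, for every `j ≥ 2`
    (∀ᵐ u : EuclideanSpace ℝ (Fin 3), u ∈ Metric.closedBall 0 R →
      ∀ j : ℕ, 2 ≤ j → (lorenz63 a b r).DerivativeAssumption R u j) ∧
    -- bounded observation errors: diameters of the supports of the smoother and of the filter
    (∀ᵐ u : EuclideanSpace ℝ (Fin 3), u ∈ Metric.closedBall 0 R →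
      ∃ h₀ : ℝ, 0 < h₀ ∧ ∀ h : ℝ, 0 < h → h < h₀ → ∀ k : ℕ, 2 ≤ k →
        ∃ Csm Cfi : ℝ, ∀ ε : ℝ, 0 < ε →
          ∀ (Ω : Type w) [MeasurableSpace Ω] (P : Measure Ω) [IsProbabilityMeasure P]
            (η : EuclideanSpace ℝ (Fin 3) → ℝ≥0∞) (Z : ℕ → Ω → EuclideanSpace ℝ (Fin 3))
            (q : EuclideanSpace ℝ (Fin 3) → ℝ≥0∞),
            IsObservationNoise P η Z → (∀ i, ∀ᵐ ω ∂P, ‖Z i ω‖ ≤ ε) →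
            (∀ z, ε < ‖z‖ → η z = 0) → IsPriorDensity R q →
            ∀ᵐ ω ∂P,
              Metric.ediam ((lorenz63 a b r).smootherSupport R h k η q
                ((lorenz63 a b r).observations h k u (fun i => Z i ω)))
                ≤ ENNReal.ofReal (Csm * ε) ∧
              Metric.ediam ((lorenz63 a b r).filterSupport R h k η q
                ((lorenz63 a b r).observations h k u (fun i => Z i ω)))
                ≤ ENNReal.ofReal (Cfi * ε)) ∧
    -- observation errors of finite variance: mean square errors of estimators
    -- that depend on the observations, but neither on the initial point nor on the noise law
    (∃ Usm Ufi : (h : ℝ) → (k : ℕ) →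
        (Fin (k + 1) → EuclideanSpace ℝ (Fin 3)) → EuclideanSpace ℝ (Fin 3),
      (∀ h k, Measurable (Usm h k)) ∧ (∀ h k, Measurable (Ufi h k)) ∧
      ∀ᵐ u : EuclideanSpace ℝ (Fin 3), u ∈ Metric.closedBall 0 R →
        ∃ h₀ : ℝ, 0 < h₀ ∧ ∀ h : ℝ, 0 < h → h < h₀ → ∀ k : ℕ, 2 ≤ k →
          ∃ Dsm Dfi : ℝ,
            ∀ (Ω : Type w) [MeasurableSpace Ω] (P : Measure Ω) [IsProbabilityMeasure P]
              (η : EuclideanSpace ℝ (Fin 3) → ℝ≥0∞) (Z : ℕ → Ω → EuclideanSpace ℝ (Fin 3)),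
              IsObservationNoise P η Z → Integrable (fun ω => ‖Z 0 ω‖ ^ 2) P →
              (Integrable (fun ω =>
                  ‖Usm h k ((lorenz63 a b r).observations h k u (fun i => Z i ω)) - u‖ ^ 2) P ∧
                ∫ ω, ‖Usm h k ((lorenz63 a b r).observations h k u (fun i => Z i ω)) - u‖ ^ 2 ∂P
                  ≤ Dsm * ∫ ω, ‖Z 0 ω‖ ^ 2 ∂P) ∧
              (Integrable (fun ω =>
                  ‖Ufi h k ((lorenz63 a b r).observations h k u (fun i => Z i ω))
                    - (lorenz63 a b r).flow (k * h) u‖ ^ 2) P ∧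
                ∫ ω, ‖Ufi h k ((lorenz63 a b r).observations h k u (fun i => Z i ω))
                    - (lorenz63 a b r).flow (k * h) u‖ ^ 2 ∂P
                  ≤ Dfi * ∫ ω, ‖Z 0 ω‖ ^ 2 ∂P)) := by
  obtain ⟨K, hK0, hK⟩ := htrap.exists_norm_flow_sub_le hR hδ
  refine ⟨?_, ?_, ?_⟩
  · filter_upwards [lorenz63.ae_coord_ne_zero_and_norm_lt R] with u hu huR j hj
    exact lorenz63.derivativeAssumption ha (hu huR).1 (hu huR).2 hj
  · filter_upwards [lorenz63.ae_coord_ne_zero_and_norm_lt R] with u hu huR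
    obtain ⟨h₀, hh₀, hobs⟩ :=
      lorenz63.exists_norm_sub_le_of_observations ha htrap hR hδ huR (hu huR).1
    refine ⟨h₀, hh₀, fun h hh hlt k hk => ?_⟩
    obtain ⟨C, -, hC⟩ := hobs h hh hlt
    -- Inner `2`: observations differ by at most `2 * ε`. Outer `2`: diameter against radius. The
    -- exponential is the Lipschitz constant of the flow up to time `k * h`.
    refine ⟨2 * (C * 2), 2 * (C * 2 * Real.exp (K * (k * h))), ?_⟩
    intro ε hε Ω _ P _ η Z q hZ hZε hη hq
    filter_upwards [ae_all_iff.2 hZε] with ω hω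
    have near : ∀ v ∈ Metric.closedBall (0 : EuclideanSpace ℝ (Fin 3)) R,
        (∀ i : Fin (k + 1), η ((lorenz63 a b r).observations h k u (fun i => Z i ω) i -
          (lorenz63 a b r).H ((lorenz63 a b r).flow ((i : ℕ) * h) v)) ≠ 0) →
        ‖v - u‖ ≤ C * (2 * ε) := fun v hv hne => hC v hv _ fun i hi =>
      (lorenz63.abs_sub_le_norm_H_sub (a := a) (b := b) (r := r) _ _).trans
        (ObservedSystem.norm_H_flow_sub_le_of_density_ne_zero (i := ⟨i, by lia⟩) hη hω (hne _))
    constructor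
    · rw [show 2 * (C * 2) * ε = 2 * (C * (2 * ε)) by ring]
      refine Metric.ediam_le_of_forall_norm_sub_le (u := u) fun v hv => ?_
      obtain ⟨hvR, hne⟩ := ObservedSystem.mem_closedBall_of_mem_smootherSupport hv
      exact near v hvR hne
    · rw [show 2 * (C * 2 * Real.exp (K * (k * h))) * ε =
        2 * (C * (2 * ε) * Real.exp (K * (k * h))) by ring]
      refine Metric.ediam_le_of_forall_norm_sub_le
        (u := (lorenz63 a b r).flow (k * h) u) fun v hv => ?_
      obtain ⟨w, hwR, rfl, hne⟩ := ObservedSystem.exists_of_mem_filterSupport hv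
      refine (hK w hwR u huR _ (by positivity)).trans ?_
      gcongr
      exact near w hwR hne
  -- The estimators are fixed before `u` and the noise are introduced, which gives the required
  -- independence.
  · choose Usm Ufi hUsm hUfi hU using fun h k => htrap.exists_least_squares hR hδ h k
    refine ⟨Usm, Ufi, hUsm, hUfi, ?_⟩
    filter_upwards [lorenz63.ae_coord_ne_zero_and_norm_lt R] with u hu huR
    obtain ⟨h₀, hh₀, hobs⟩ :=
      lorenz63.exists_norm_sub_le_of_observations ha htrap hR hδ huR (hu huR).1
    refine ⟨h₀, hh₀, fun h hh hlt k hk => ?_⟩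
    obtain ⟨C, hC0, hC⟩ := hobs h hh hlt
    -- The factor `k + 1` counts the identically distributed noise terms in the total squared noise.
    refine ⟨(C * 2) ^ 2 * (k + 1 : ℕ),
      (C * 2 * Real.exp (K * (k * h))) ^ 2 * (k + 1 : ℕ), ?_⟩
    intro Ω _ P _ η Z hZ hZ2
    have hY := (lorenz63 a b r).measurable_observations hZ.measurable h k u
    have near : ∀ ω, ‖Usm h k ((lorenz63 a b r).observations h k u fun i => Z i ω) - u‖ ≤
        C * (2 * √(∑ i : Fin (k + 1), ‖Z i ω‖ ^ 2)) := by
      intro ω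
      obtain ⟨hm, hmin, -⟩ := hU h k hh ((lorenz63 a b r).observations h k u fun i => Z i ω)
      exact hC _ hm _ fun i hi =>
        (lorenz63.abs_sub_le_norm_H_sub (a := a) (b := b) (r := r) _ _).trans
          (ObservedSystem.norm_H_flow_sub_le_of_residual_le (z := fun i => Z i ω)
            (hmin u huR) ⟨i, by lia⟩)
    have hsq : ∀ ω, √(∑ i : Fin (k + 1), ‖Z i ω‖ ^ 2) ^ 2 = ∑ i : Fin (k + 1), ‖Z i ω‖ ^ 2 :=
      fun ω => Real.sq_sqrt (by positivity)
    constructor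
    · refine hZ.integrable_and_integral_le hZ2
        ((((hUsm h k).comp hY).sub_const u).norm.pow_const 2) (fun ω => by positivity) fun ω => ?_
      rw [← hsq ω, ← mul_pow, mul_assoc]
      exact pow_le_pow_left₀ (norm_nonneg _) (near ω) 2
    · refine hZ.integrable_and_integral_le hZ2
        ((((hUfi h k).comp hY).sub_const _).norm.pow_const 2) (fun ω => by positivity) fun ω => ?_
      obtain ⟨hm, -, hfi⟩ := hU h k hh ((lorenz63 a b r).observations h k u fun i => Z i ω)
      rw [← hsq ω, ← mul_pow, Function.comp_apply, hfi]
      refine pow_le_pow_left₀ (norm_nonneg _) ((hK _ hm u huR _ (by positivity)).trans ?_) 2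
      rw [show C * 2 * Real.exp (K * (k * h)) * √(∑ i : Fin (k + 1), ‖Z i ω‖ ^ 2) =
        C * (2 * √(∑ i : Fin (k + 1), ‖Z i ω‖ ^ 2)) * Real.exp (K * (k * h)) by ring]
      gcongr
      exact near ω
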